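/- Let $X$ and $Y$ be complex Banach spaces, let $A\colon D(A)\subset X\to X$ and $D\colon D(D)\subset Y\to Y$ be the generators of $C_0$-semigroups $(e^{tA})_{t\ge 0}$ on $X$ and $(e^{tD})_{t\ge 0}$ on $Y$, and let $C\colon X\to Y$ be a bounded linear operator. Consider on $X\times Y$ the operator matrix $$\mathbf A=\begin{pmatrix} A & 0\\ C & D\end{pmatrix},\qquad D(\mathbf A)=D(A)\times D(D),$$ and put $R(t)x=\int_0^t e^{(t-s)D}Ce^{sA}x\,ds$ for $t\ge 0$ and $x\in X$. Assume that $(e^{tA})_{t\ge0}$ is uniformly exponentially stable, i.e. there are $M\in\mathbb R$ and $\omega>0$ with $\|e^{tA}\|\le Me^{-\omega t}$ for all $t\ge 0$, and that $(e^{tD})_{t\ge 0}$ is bounded, i.e. $\sup_{t\ge 0}\|e^{tD}\|<\infty$. Then $\mathbf A$ generates a $C_0$-semigroup $(e^{t\mathbf A})_{t\ge 0}$ on $X\times Y$, and the following hold. 1. The semigroup $(e^{t\mathbf A})_{t\ge 0}$ is bounded. 2. If $(e^{tD})_{t\ge 0}$ is asymptotically almost periodic, then $(R(t))_{t\ge 0}$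 is asymptotically almost periodic. 3. If $\lim_{t\to\infty}e^{tD}$ exists in the strong operator topology, then $\lim_{t\to\infty}e^{t\mathbf A}$ exists in the strong operator topology. If $\lim_{t\to\infty}e^{tD}=0$ in the strong operator topology, then $\lim_{t\to\infty}e^{t\mathbf A}=0$ in the strong operator topology. Here a function $f\colon[0,\infty)\to E$ with values in a complex Banach space $E$ is called asymptotically almost periodic if $f=g+h$, where $g$ is a uniform limit on $[0,\infty)$ of linear combinations of functions $t\mapsto e^{i\eta t}x$ ($\eta\in\mathbb R$, $x\in E$) and $h$ is continuous with $\lim_{t\to\infty}h(t)=0$; a family of operators is called asymptotically almost periodic if all its orbits (the functions obtained by applying it to a fixed vector) are. -/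

import Mathlib

open Filter Topology Set MeasureTheory

/-- `T` (only its values at `t ≥ 0` matter) is a strongly continuous one-parameter semigroup of
bounded linear operators on `E`. -/
structure IsC0Semigroup {E : Type*} [NormedAddCommGroup E] [NormedSpace ℂ E]
    (T : ℝ → E →L[ℂ] E) : Prop where
  map_zero : T 0 = ContinuousLinearMap.id ℂ E
  map_add : ∀ s t : ℝ, 0 ≤ s → 0 ≤ t → T (s + t) = (T s).comp (T t)
  continuousOn_orbit : ∀ x : E, ContinuousOn (fun t : ℝ => T t x) (Ici 0)

/-- The (possibly unbounded) operator `A` generates the `C₀`-semigroup `T`: the domain of `A` is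
the set of those `x` for which `(T t x - x) / t` has a limit as `t → 0+`, and `A x` is this
limit. -/
def Generates {E : Type*} [NormedAddCommGroup E] [NormedSpace ℂ E]
    (A : E →ₗ.[ℂ] E) (T : ℝ → E →L[ℂ] E) : Prop :=
  IsC0Semigroup T ∧
    ∀ x y : E, (x, y) ∈ A.graph ↔
      Tendsto (fun t : ℝ => (t : ℂ)⁻¹ • (T t x - x)) (𝓝[>] 0) (𝓝 y)

/-- `T` is bounded on `[0, ∞)` in operator norm. -/
def BoundedSemigroup {E : Type*} [NormedAddCommGroup E] [NormedSpace ℂ E]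
    (T : ℝ → E →L[ℂ] E) : Prop :=
  ∃ M : ℝ, ∀ t : ℝ, 0 ≤ t → ‖T t‖ ≤ M

/-- `T` is uniformly exponentially stable. -/
def UniformlyExpStable {E : Type*} [NormedAddCommGroup E] [NormedSpace ℂ E]
    (T : ℝ → E →L[ℂ] E) : Prop :=
  ∃ M ω : ℝ, 0 < ω ∧ ∀ t : ℝ, 0 ≤ t → ‖T t‖ ≤ M * Real.exp (-ω * t)

/-- `T t` converges to `P` in the strong operator topology as `t → ∞`. -/
def TendstoStrongly {E : Type*} [NormedAddCommGroup E] [NormedSpace ℂ E]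
    (T : ℝ → E →L[ℂ] E) (P : E →L[ℂ] E) : Prop :=
  ∀ x : E, Tendsto (fun t : ℝ => T t x) atTop (𝓝 (P x))

/-- The `E`-valued trigonometric polynomials: the linear span of the functions
`t ↦ exp (i η t) • x` with `η` real and `x` in `E`. -/
def trigPolynomials (E : Type*) [NormedAddCommGroup E] [NormedSpace ℂ E] :
    Submodule ℂ (ℝ → E) :=
  Submodule.span ℂ
    {p | ∃ (η : ℝ) (x : E), p = fun t : ℝ => Complex.exp (Complex.I * η * t) • x}

/-- `g` is almost periodic on `[0, ∞)`: a uniform limit there of trigonometric polynomials. -/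
def AlmostPeriodic {E : Type*} [NormedAddCommGroup E] [NormedSpace ℂ E] (g : ℝ → E) : Prop :=
  ∀ ε : ℝ, 0 < ε → ∃ p ∈ trigPolynomials E, ∀ t : ℝ, 0 ≤ t → ‖g t - p t‖ < ε

/-- `f` is asymptotically almost periodic on `[0, ∞)`: there it is the sum of an almost periodic
function and a continuous function vanishing at infinity. -/
def AsympAlmostPeriodic {E : Type*} [NormedAddCommGroup E] [NormedSpace ℂ E]
    (f : ℝ → E) : Prop :=
  ∃ g h : ℝ → E, AlmostPeriodic g ∧ ContinuousOn h (Ici 0) ∧ Tendsto h atTop (𝓝 0) ∧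
    ∀ t : ℝ, 0 ≤ t → f t = g t + h t

/-- The operator matrix with rows `(A, B)` and `(C, D)`, with bounded off-diagonal entries and
diagonal domain `D(A) × D(D)`, as an operator on `X × Y`. -/
def operatorMatrix {X Y : Type*} [NormedAddCommGroup X] [NormedSpace ℂ X]
    [NormedAddCommGroup Y] [NormedSpace ℂ Y]
    (A : X →ₗ.[ℂ] X) (B : Y →L[ℂ] X) (C : X →L[ℂ] Y) (D : Y →ₗ.[ℂ] Y) :
    (X × Y) →ₗ.[ℂ] (X × Y) where
  domain := A.domain.prod D.domain
  toFun :=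
    { toFun := fun z => (A ⟨z.1.1, z.2.1⟩ + B z.1.2, C z.1.1 + D ⟨z.1.2, z.2.2⟩)
      map_add' := by
        intro z w
        have h1 := A.map_add ⟨z.1.1, z.2.1⟩ ⟨w.1.1, w.2.1⟩
        have h2 := D.map_add ⟨z.1.2, z.2.2⟩ ⟨w.1.2, w.2.2⟩
        simp only [AddMemClass.mk_add_mk] at h1 h2
        refine Prod.ext ?_ ?_
        · simp [h1]; abel
        · simp [h2]; abel
      map_smul' := by
        intro c z
        have h1 := A.map_smul c ⟨z.1.1, z.2.1⟩
        have h2 := D.map_smul c ⟨z.1.2, z.2.2⟩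
        simp only [SetLike.mk_smul_mk] at h1 h2
        refine Prod.ext ?_ ?_
        · simp [h1]
        · simp [h2] }

/-- `R t x = ∫₀ᵗ TD (t - s) C TA s x ds`. -/
noncomputable def convolutionR {X Y : Type*} [NormedAddCommGroup X] [NormedSpace ℂ X]
    [NormedAddCommGroup Y] [NormedSpace ℂ Y]
    (TA : ℝ → X →L[ℂ] X) (C : X →L[ℂ] Y) (TD : ℝ → Y →L[ℂ] Y) (t : ℝ) (x : X) : Y :=
  ∫ s in (0 : ℝ)..t, TD (t - s) (C (TA s x))

/-!
The operator matrix is lower triangular, so its semigroup is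
`T t (x, y) = (TA t x, R t x + TD t y)` with the convolution `R t x = ∫₀ᵗ TD (t - s) C TA s x ds`.
The semigroup law amounts to the cocycle identity `R (s + t) = TD s R t + R s TA t`
(`convolutionR_add_time`), and the generator is read off from `R h x / h → C x` as `h → 0+`
(`exists_generates_operatorMatrix`). Exponential stability of `TA` bounds `R` uniformly on
`[0, ∞)`; hence `T` is bounded, and so is every semigroup with the same generator, because a
generator determines its semigroup (`Generates.unique`).

For the asymptotics, the cocycle identity is used in the form
`R t x = TD (t - S) (R S x) + R (t - S) (TA S x)`.
Since `TA S x → 0` and `R` is bounded, `R t x` is, up to an arbitrarily small error that is uniform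
in `t ≥ S`, a translate of an orbit of `TD` (`exists_norm_convolutionR_sub_le`). Each of the
asymptotic properties in question passes to functions that can be so approximated. For convergence
this is completeness. For asymptotic almost periodicity
(`asympAlmostPeriodic_of_forall_exists_eventually`) it rests on recurrence: the norm of a
trigonometric polynomial is bounded everywhere by its bound near infinity
(`norm_le_of_eventually_norm_le`).
-/

/-! ### Asymptotically almost periodic functions -/

section AlmostPeriodic

variable {E : Type*} [NormedAddCommGroup E] [NormedSpace ℂ E]

lemma norm_exp_I_mul_mul (η t : ℝ) : ‖Complex.exp (Complex.I * η * t)‖ = 1 := by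
  rw [show Complex.I * η * t = ((η * t : ℝ) : ℂ) * Complex.I by push_cast; ring]
  exact Complex.norm_exp_ofReal_mul_I _

/-- Along an ultrafilter tending to infinity every character `t ↦ exp (i η t)` converges on the
unit circle, so along the differences `τ - σ`, with `τ` sent to infinity before `σ`, every
character tends to `1`. This replaces simultaneous Diophantine approximation. -/
lemma exists_recurrence_filter :
    ∃ F : Filter ℝ, F.NeBot ∧ F ≤ atTop ∧
      ∀ η : ℝ, Tendsto (fun τ : ℝ => Complex.exp (Complex.I * η * τ)) F (𝓝 1) := by
  set U : Ultrafilter ℝ := Ultrafilter.of atTop with hU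
  have hUle : (U : Filter ℝ) ≤ atTop := Ultrafilter.of_le _
  refine ⟨(U : Filter ℝ).bind (fun σ => map (fun τ => τ - σ) (U : Filter ℝ)), ?_, ?_, ?_⟩
  · refine ⟨fun h => ?_⟩
    have h0 : ∀ᶠ _ in (U : Filter ℝ).bind (fun σ => map (fun τ => τ - σ) (U : Filter ℝ)),
        False := by
      rw [h]; exact eventually_bot
    simp [eventually_bind, U.neBot.ne] at h0
  · intro s hs
    change ∀ᶠ x in (U : Filter ℝ).bind (fun σ => map (fun τ => τ - σ) (U : Filter ℝ)), x ∈ s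
    rw [eventually_bind]
    refine Eventually.of_forall fun σ => ?_
    have : Tendsto (fun τ : ℝ => τ - σ) U atTop :=
      (tendsto_atTop_add_const_right atTop (-σ) tendsto_id).mono_left hUle
    exact this hs
  · intro η
    obtain ⟨c, -, hc⟩ := (isCompact_sphere (0 : ℂ) 1).ultrafilter_le_nhds
      (U.map fun τ : ℝ => Complex.exp (Complex.I * η * τ))
      (by
        rw [le_principal_iff]
        exact Eventually.of_forall (f := (U : Filter ℝ)) fun τ =>
          mem_sphere_zero_iff_norm.2 (norm_exp_I_mul_mul η τ))
    have hc' : Tendsto (fun τ : ℝ => Complex.exp (Complex.I * η * τ)) U (𝓝 c) := hc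
    rw [Metric.tendsto_nhds] at hc' ⊢
    intro ε hε
    rw [eventually_bind]
    filter_upwards [hc' (ε / 2) (half_pos hε)] with σ hσ
    rw [eventually_map]
    filter_upwards [hc' (ε / 2) (half_pos hε)] with τ hτ
    have key : Complex.exp (Complex.I * η * (τ - σ : ℝ)) - 1
        = Complex.exp (Complex.I * η * (-σ : ℝ)) *
          (Complex.exp (Complex.I * η * τ) - Complex.exp (Complex.I * η * σ)) := by
      rw [mul_sub, ← Complex.exp_add, ← Complex.exp_add]
      have h1 : Complex.I * η * (-σ : ℝ) + Complex.I * η * σ = 0 := by push_cast; ring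
      have h2 : Complex.I * η * (-σ : ℝ) + Complex.I * η * τ = Complex.I * η * (τ - σ : ℝ) := by
        push_cast; ring
      rw [h1, h2, Complex.exp_zero]
    rw [dist_eq_norm, key, norm_mul, norm_exp_I_mul_mul, one_mul, ← dist_eq_norm]
    linarith [dist_triangle_right (Complex.exp (Complex.I * η * τ))
      (Complex.exp (Complex.I * η * σ)) c]

lemma continuous_of_mem_trigPolynomials {p : ℝ → E} (hp : p ∈ trigPolynomials E) :
    Continuous p := by
  induction hp using Submodule.span_induction with
  | mem p hp => obtain ⟨η, x, rfl⟩ := hp; fun_prop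
  | zero => exact continuous_const
  | add p q _ _ hp hq => exact hp.add hq
  | smul a p _ hp => exact hp.const_smul a

lemma comp_add_const_mem_trigPolynomials {p : ℝ → E} (hp : p ∈ trigPolynomials E) (a : ℝ) :
    (fun t => p (t + a)) ∈ trigPolynomials E := by
  induction hp using Submodule.span_induction with
  | mem p hp =>
    obtain ⟨η, x, rfl⟩ := hp
    refine Submodule.subset_span ⟨η, Complex.exp (Complex.I * η * a) • x, ?_⟩
    funext t
    rw [smul_smul, ← Complex.exp_add]
    push_cast
    ring_nf
  | zero => exact Submodule.zero_mem _
  | add p q _ _ hp hq => exact Submodule.add_mem _ hp hq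
  | smul a p _ hp => exact Submodule.smul_mem _ a hp

/-- A bound that a trigonometric polynomial satisfies near infinity holds everywhere. -/
lemma norm_le_of_eventually_norm_le {p : ℝ → E} (hp : p ∈ trigPolynomials E) {ε : ℝ}
    (h : ∀ᶠ t in atTop, ‖p t‖ ≤ ε) (t : ℝ) : ‖p t‖ ≤ ε := by
  obtain ⟨F, hne, hle, hF⟩ := exists_recurrence_filter
  have key : Tendsto (fun τ => p (t + τ)) F (𝓝 (p t)) := by
    clear h
    induction hp using Submodule.span_induction with
    | mem p hp =>
      obtain ⟨η, x, rfl⟩ := hp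
      have : ∀ τ : ℝ, Complex.exp (Complex.I * η * (t + τ : ℝ))
          = Complex.exp (Complex.I * η * t) * Complex.exp (Complex.I * η * τ) := fun τ => by
        rw [← Complex.exp_add]; congr 1; push_cast; ring
      simp only [this]
      simpa using ((hF η).const_mul (Complex.exp (Complex.I * η * t))).smul_const x
    | zero => exact tendsto_const_nhds
    | add p q _ _ hp hq => exact hp.add hq
    | smul a p _ hp => exact hp.const_smul a
  refine le_of_tendsto key.norm ?_
  exact hle ((tendsto_atTop_add_const_left atTop t tendsto_id).eventually h)

lemma AsympAlmostPeriodic.exists_eventually_norm_sub_le {f : ℝ → E}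
    (hf : AsympAlmostPeriodic f) {ε : ℝ} (hε : 0 < ε) :
    ∃ p ∈ trigPolynomials E, ∀ᶠ t in atTop, ‖f t - p t‖ ≤ ε := by
  obtain ⟨g, h, hg, -, h0, hfgh⟩ := hf
  obtain ⟨p, hp, hgp⟩ := hg (ε / 2) (half_pos hε)
  refine ⟨p, hp, ?_⟩
  filter_upwards [eventually_ge_atTop 0, Metric.tendsto_nhds.1 h0 (ε / 2) (half_pos hε)]
    with t ht hht
  rw [dist_zero_right] at hht
  rw [hfgh t ht, show g t + h t - p t = (g t - p t) + h t by abel]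
  linarith [norm_add_le (g t - p t) (h t), hgp t ht]

/-- The approximating trigonometric polynomials are uniformly Cauchy near infinity, hence
everywhere by recurrence, and their limit is the almost periodic part. -/
lemma asympAlmostPeriodic_of_forall_exists_eventually [CompleteSpace E] {f : ℝ → E}
    (hc : ContinuousOn f (Ici 0))
    (hf : ∀ ε : ℝ, 0 < ε → ∃ p ∈ trigPolynomials E, ∀ᶠ t in atTop, ‖f t - p t‖ ≤ ε) :
    AsympAlmostPeriodic f := by
  choose p hp hfp using fun n : ℕ => hf (1 / ((n : ℝ) + 1)) Nat.one_div_pos_of_nat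
  have hpp : ∀ n m t, ‖p n t - p m t‖ ≤ 1 / ((n : ℝ) + 1) + 1 / ((m : ℝ) + 1) := by
    intro n m t
    refine norm_le_of_eventually_norm_le (Submodule.sub_mem _ (hp n) (hp m)) ?_ t
    filter_upwards [hfp n, hfp m] with s hn hm
    rw [Pi.sub_apply, show p n s - p m s = (f s - p m s) - (f s - p n s) by abel]
    linarith [norm_sub_le (f s - p m s) (f s - p n s)]
  have hlim0 := tendsto_one_div_add_atTop_nhds_zero_nat (𝕜 := ℝ)
  have hcauchy : ∀ t, CauchySeq fun n => p n t := by
    intro t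
    refine cauchySeq_of_le_tendsto_0 (fun n : ℕ => 1 / ((n : ℝ) + 1) + 1 / ((n : ℝ) + 1))
      (fun n m N hn hm => ?_) (by simpa using hlim0.add hlim0)
    rw [dist_eq_norm]
    exact (hpp n m t).trans (add_le_add (Nat.one_div_le_one_div hn) (Nat.one_div_le_one_div hm))
  choose g hg using fun t => cauchySeq_tendsto_of_complete (hcauchy t)
  have hgp : ∀ n t, ‖g t - p n t‖ ≤ 1 / ((n : ℝ) + 1) := by
    intro n t
    have h1 : Tendsto (fun m => ‖p m t - p n t‖) atTop (𝓝 ‖g t - p n t‖) :=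
      ((hg t).sub_const _).norm
    have h2 := hlim0.add_const (1 / ((n : ℝ) + 1))
    rw [zero_add] at h2
    exact le_of_tendsto_of_tendsto' h1 h2 fun m => hpp m n t
  have hunif : TendstoUniformly p g atTop := by
    rw [Metric.tendstoUniformly_iff]
    intro ε hε
    filter_upwards [hlim0.eventually (gt_mem_nhds hε)] with n hn t
    rw [dist_eq_norm]
    exact (hgp n t).trans_lt hn
  have hgc : Continuous g := hunif.continuous
    (Frequently.of_forall fun n => continuous_of_mem_trigPolynomials (hp n))
  refine ⟨g, fun t => f t - g t, ?_, hc.sub hgc.continuousOn, ?_,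
    fun t _ => (add_sub_cancel _ _).symm⟩
  · intro ε hε
    obtain ⟨n, hn⟩ := exists_nat_one_div_lt hε
    exact ⟨p n, hp n, fun t _ => (hgp n t).trans_lt hn⟩
  · rw [Metric.tendsto_nhds]
    intro ε hε
    obtain ⟨n, hn⟩ := exists_nat_one_div_lt (half_pos hε)
    filter_upwards [hfp n] with t ht
    rw [dist_zero_right, show f t - g t = (f t - p n t) - (g t - p n t) by abel]
    linarith [norm_sub_le (f t - p n t) (g t - p n t), hgp n t]

end AlmostPeriodic

/-! ### Strongly continuous semigroups and their generators -/

section Semigroup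

variable {E : Type*} [NormedAddCommGroup E] [NormedSpace ℂ E]

/-- If the integrands `F h` are uniformly close to `y` on `[0, h]` as `h → 0+`, then their means
over `[0, h]` tend to `y`. The integrand may depend on `h`, as it does in a convolution. -/
lemma tendsto_inv_smul_integral {F : ℝ → ℝ → E} {y : E} [CompleteSpace E]
    (hcont : ∀ h : ℝ, 0 ≤ h → ContinuousOn (F h) (Icc 0 h))
    (hF : ∀ ε : ℝ, 0 < ε → ∀ᶠ h in 𝓝[>] (0 : ℝ), ∀ s ∈ Icc 0 h, ‖F h s - y‖ ≤ ε) :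
    Tendsto (fun h : ℝ => (h : ℂ)⁻¹ • ∫ s in (0 : ℝ)..h, F h s) (𝓝[>] 0) (𝓝 y) := by
  rw [Metric.tendsto_nhds]
  intro ε hε
  filter_upwards [hF (ε / 2) (half_pos hε), self_mem_nhdsWithin] with h hh h0
  have h0 : 0 < h := h0
  have hint : IntervalIntegrable (F h) volume 0 h :=
    (hcont h h0.le).intervalIntegrable_of_Icc h0.le
  have e1 : ∫ s in (0 : ℝ)..h, (F h s - y) = (∫ s in (0 : ℝ)..h, F h s) - (h : ℂ) • y := by
    rw [intervalIntegral.integral_sub hint intervalIntegrable_const,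
      intervalIntegral.integral_const, sub_zero, Complex.coe_smul]
  have e2 : ‖∫ s in (0 : ℝ)..h, (F h s - y)‖ ≤ ε / 2 * |h - 0| :=
    intervalIntegral.norm_integral_le_of_norm_le_const fun s hs => by
      rw [uIoc_of_le h0.le] at hs
      exact hh s ⟨hs.1.le, hs.2⟩
  have hne : (h : ℂ) ≠ 0 := by exact_mod_cast h0.ne'
  have e3 : (h : ℂ)⁻¹ • (∫ s in (0 : ℝ)..h, F h s) - y
      = (h : ℂ)⁻¹ • ∫ s in (0 : ℝ)..h, (F h s - y) := by
    rw [e1, smul_sub, inv_smul_smul₀ hne]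
  rw [dist_eq_norm, e3, norm_smul, norm_inv, Complex.norm_real, Real.norm_of_nonneg h0.le]
  rw [sub_zero, abs_of_pos h0] at e2
  calc h⁻¹ * ‖∫ s in (0 : ℝ)..h, (F h s - y)‖ ≤ h⁻¹ * (ε / 2 * h) := by gcongr
    _ = ε / 2 := by field_simp
    _ < ε := by linarith

/-- For a bounded semigroup, right continuity of the orbits at `0` already gives strong
continuity. -/
lemma isC0Semigroup_of_bounded {T : ℝ → E →L[ℂ] E} {K : ℝ}
    (h0 : T 0 = ContinuousLinearMap.id ℂ E)
    (hadd : ∀ s t : ℝ, 0 ≤ s → 0 ≤ t → T (s + t) = (T s).comp (T t))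
    (hK : ∀ t, 0 ≤ t → ‖T t‖ ≤ K)
    (hlim : ∀ x, Tendsto (fun t => T t x) (𝓝[>] 0) (𝓝 x)) : IsC0Semigroup T := by
  refine ⟨h0, hadd, fun x => ?_⟩
  have hKpos : 0 < K + 1 := by linarith [(norm_nonneg _).trans (hK 0 le_rfl)]
  rw [Metric.continuousOn_iff]
  intro b hb ε hε
  have hev := Metric.tendsto_nhds.1 (hlim x) (ε / (K + 1)) (div_pos hε hKpos)
  rw [eventually_nhdsWithin_iff, Metric.eventually_nhds_iff] at hev
  obtain ⟨δ, hδ, hev⟩ := hev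
  have key : ∀ s t : ℝ, 0 ≤ s → s < t → t - s < δ → ‖T t x - T s x‖ < ε := by
    intro s t hs hst hδ'
    have h1 : ‖T (t - s) x - x‖ < ε / (K + 1) := by
      rw [← dist_eq_norm]
      refine hev ?_ (sub_pos.2 hst)
      rw [dist_zero_right, Real.norm_of_nonneg (sub_pos.2 hst).le]
      exact hδ'
    have h2 : T t x - T s x = T s (T (t - s) x - x) := by
      rw [map_sub, ← ContinuousLinearMap.comp_apply, ← hadd s (t - s) hs (sub_pos.2 hst).le,
        add_sub_cancel]
    rw [h2]
    calc ‖T s (T (t - s) x - x)‖ ≤ (K + 1) * ‖T (t - s) x - x‖ :=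
          (T s).le_of_opNorm_le ((hK s hs).trans (by linarith)) _
      _ < (K + 1) * (ε / (K + 1)) := by gcongr
      _ = ε := by field_simp
  refine ⟨δ, hδ, fun a ha hab => ?_⟩
  rw [Real.dist_eq, abs_lt] at hab
  rcases lt_trichotomy a b with h | h | h
  · rw [dist_comm, dist_eq_norm]
    exact key a b ha h (by linarith)
  · simpa [h] using hε
  · rw [dist_eq_norm]
    exact key b a hb h (by linarith)

variable {S T : ℝ → E →L[ℂ] E}

lemma IsC0Semigroup.tendsto_zero_right (hT : IsC0Semigroup T) (x : E) :
    Tendsto (fun t => T t x) (𝓝[>] 0) (𝓝 x) := by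
  have h := (hT.continuousOn_orbit x 0 self_mem_Ici).mono Ioi_subset_Ici_self
  simpa [ContinuousWithinAt, hT.map_zero] using h

lemma IsC0Semigroup.intervalIntegrable (hT : IsC0Semigroup T) (x : E) {a b : ℝ} (ha : 0 ≤ a)
    (hb : 0 ≤ b) : IntervalIntegrable (fun s => T s x) volume a b :=
  ((hT.continuousOn_orbit x).mono fun _ hs => (le_min ha hb).trans hs.1).intervalIntegrable

lemma Generates.map_mem_graph {A : E →ₗ.[ℂ] E} (hA : Generates A T) {x y : E}
    (hxy : (x, y) ∈ A.graph) {s : ℝ} (hs : 0 ≤ s) : (T s x, T s y) ∈ A.graph := by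
  rw [hA.2] at hxy ⊢
  refine (((T s).continuous.tendsto y).comp hxy).congr' ?_
  filter_upwards [self_mem_nhdsWithin] with h hh
  have hh : 0 ≤ h := le_of_lt hh
  have : T s (T h x) = T h (T s x) := by
    rw [← ContinuousLinearMap.comp_apply, ← hA.1.map_add s h hs hh, add_comm,
      hA.1.map_add h s hh hs, ContinuousLinearMap.comp_apply]
  simp [this]

variable [CompleteSpace E]

lemma IsC0Semigroup.exists_norm_le_of_le (hT : IsC0Semigroup T) (b : ℝ) :
    ∃ K : ℝ, 0 ≤ K ∧ ∀ t, 0 ≤ t → t ≤ b → ‖T t‖ ≤ K := by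
  obtain ⟨K, hK⟩ := banach_steinhaus (g := fun t : Icc (0 : ℝ) b => T t) (fun x => by
    obtain ⟨K, hK⟩ := isCompact_Icc.exists_bound_of_continuousOn
      ((hT.continuousOn_orbit x).mono (Icc_subset_Ici_self : Icc 0 b ⊆ Ici 0))
    exact ⟨K, fun t => hK t t.2⟩)
  exact ⟨max K 0, le_max_right _ _, fun t h0 hb => (hK ⟨t, h0, hb⟩).trans (le_max_left _ _)⟩

/-- Joint continuity of `(t, x) ↦ T t x` on `[0, ∞) × E`. -/
lemma IsC0Semigroup.tendsto_apply (hT : IsC0Semigroup T) {α : Type*} {l : Filter α}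
    {r : α → ℝ} {v : α → E} {r₀ : ℝ} {v₀ : E} (hr : Tendsto r l (𝓝 r₀))
    (hr' : ∀ᶠ a in l, 0 ≤ r a) (hr₀ : 0 ≤ r₀) (hv : Tendsto v l (𝓝 v₀)) :
    Tendsto (fun a => T (r a) (v a)) l (𝓝 (T r₀ v₀)) := by
  obtain ⟨K, hK0, hK⟩ := hT.exists_norm_le_of_le (r₀ + 1)
  have h1 : Tendsto (fun a => T (r a) v₀) l (𝓝 (T r₀ v₀)) :=
    (hT.continuousOn_orbit v₀ r₀ hr₀).tendsto.comp (tendsto_nhdsWithin_iff.2 ⟨hr, hr'⟩)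
  have h2 : Tendsto (fun a => T (r a) (v a - v₀)) l (𝓝 0) := by
    refine squeeze_zero_norm' (a := fun a => K * ‖v a - v₀‖) ?_ ?_
    · filter_upwards [hr', hr.eventually (gt_mem_nhds (lt_add_one r₀))] with a h0 h1
      exact (T (r a)).le_of_opNorm_le (hK _ h0 h1.le) _
    · simpa using ((hv.sub_const v₀).norm).const_mul K
  simpa using h2.add h1

lemma IsC0Semigroup.continuousOn_apply (hT : IsC0Semigroup T) {s : Set ℝ} {r : ℝ → ℝ} {v : ℝ → E}
    (hr : ContinuousOn r s) (hr0 : ∀ a ∈ s, 0 ≤ r a) (hv : ContinuousOn v s) :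
    ContinuousOn (fun a => T (r a) (v a)) s := fun a ha =>
  hT.tendsto_apply (hr a ha) (eventually_mem_nhdsWithin.mono hr0) (hr0 a ha) (hv a ha)

lemma IsC0Semigroup.tendsto_inv_smul_integral (hT : IsC0Semigroup T) (x : E) {t : ℝ}
    (ht : 0 ≤ t) :
    Tendsto (fun h : ℝ => (h : ℂ)⁻¹ • ∫ s in t..(t + h), T s x) (𝓝[>] 0) (𝓝 (T t x)) := by
  have hcont : ContinuousOn (fun s => T (s + t) x) (Ici 0) :=
    hT.continuousOn_apply (by fun_prop) (fun a (ha : 0 ≤ a) => by linarith) continuousOn_const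
  have := _root_.tendsto_inv_smul_integral (F := fun _ s => T (s + t) x) (y := T t x)
    (fun h _ => hcont.mono Icc_subset_Ici_self) (fun ε hε => by
      have h1 := hcont 0 self_mem_Ici
      rw [Metric.continuousWithinAt_iff] at h1
      obtain ⟨δ, hδ, h1⟩ := h1 ε hε
      filter_upwards [Ioo_mem_nhdsGT hδ] with h hh s hs
      have h2 := h1 (x := s) hs.1 (by
        rw [dist_zero_right, Real.norm_of_nonneg hs.1]; exact hs.2.trans_lt hh.2)
      rw [zero_add, dist_eq_norm] at h2
      exact h2.le)
  refine this.congr fun h => ?_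
  rw [intervalIntegral.integral_comp_add_right (fun s => T s x), zero_add, add_comm h t]

/-- The vector `∫₀ᵗ T s x ds` lies in the domain of the generator, which maps it to
`T t x - x`. -/
lemma Generates.integral_mem_graph {A : E →ₗ.[ℂ] E} (hA : Generates A T) (x : E) {t : ℝ}
    (ht : 0 ≤ t) : (∫ s in (0 : ℝ)..t, T s x, T t x - x) ∈ A.graph := by
  have hT := hA.1
  rw [hA.2]
  have h0 := hT.tendsto_inv_smul_integral x le_rfl
  simp only [hT.map_zero, ContinuousLinearMap.id_apply, zero_add] at h0
  refine ((hT.tendsto_inv_smul_integral x ht).sub h0).congr' ?_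
  filter_upwards [self_mem_nhdsWithin] with h hh
  have hh : 0 ≤ h := le_of_lt hh
  rw [← smul_sub]
  congr 1
  have e1 : T h (∫ s in (0 : ℝ)..t, T s x) = ∫ s in h..(t + h), T s x := by
    rw [← ContinuousLinearMap.intervalIntegral_comp_comm _ (hT.intervalIntegrable x le_rfl ht)]
    have : ∫ s in h..(t + h), T s x = ∫ s in (0 : ℝ)..t, T (s + h) x := by
      rw [intervalIntegral.integral_comp_add_right (fun s => T s x), zero_add]
    rw [this]
    refine intervalIntegral.integral_congr fun s hs => ?_
    rw [uIcc_of_le ht] at hs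
    change T h (T s x) = T (s + h) x
    rw [add_comm, hT.map_add h s hh hs.1, ContinuousLinearMap.comp_apply]
  have i1 := hT.intervalIntegrable x hh (add_nonneg ht hh)
  have i2 := hT.intervalIntegrable x le_rfl hh
  have i3 := hT.intervalIntegrable x le_rfl ht
  have i4 := hT.intervalIntegrable x ht (add_nonneg ht hh)
  have e2 := intervalIntegral.integral_add_adjacent_intervals i2 i1
  have e3 := intervalIntegral.integral_add_adjacent_intervals i3 i4
  rw [e1, sub_eq_sub_iff_add_eq_add, add_comm, e3, ← e2, add_comm]

lemma Generates.dense_domain {A : E →ₗ.[ℂ] E} (hA : Generates A T) :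
    Dense (A.domain : Set E) := by
  intro x
  have h0 := hA.1.tendsto_inv_smul_integral x le_rfl
  simp only [hA.1.map_zero, ContinuousLinearMap.id_apply, zero_add] at h0
  refine mem_closure_of_tendsto h0 ?_
  filter_upwards [self_mem_nhdsWithin] with h hh
  exact A.domain.smul_mem _
    (LinearPMap.mem_domain_iff.2 ⟨_, hA.integral_mem_graph x (le_of_lt hh)⟩)

/-- A generator determines its semigroup: for `x` in the domain, `s ↦ T (t - s) (S s x)` has right
derivative zero on `[0, t)`, and the domain is dense. -/
lemma Generates.unique {A : E →ₗ.[ℂ] E} (hS : Generates A S) (hT : Generates A T) {t : ℝ}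
    (ht : 0 ≤ t) : S t = T t := by
  refine ContinuousLinearMap.coeFn_injective
    (Continuous.ext_on hS.dense_domain (S t).continuous (T t).continuous fun x hx => ?_)
  obtain ⟨y, hxy⟩ := LinearPMap.mem_domain_iff.1 hx
  have hcont : ContinuousOn (fun s => T (t - s) (S s x)) (Icc 0 t) :=
    hT.1.continuousOn_apply (by fun_prop) (fun a ha => sub_nonneg.2 ha.2)
      ((hS.1.continuousOn_orbit x).mono Icc_subset_Ici_self)
  have hderiv : ∀ s ∈ Ico 0 t,
      HasDerivWithinAt (fun s => T (t - s) (S s x)) 0 (Ici s) s := by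
    intro s hs
    have hz := hS.map_mem_graph hxy hs.1
    have h1 := ((hS.2 _ _).1 hz).sub ((hT.2 _ _).1 hz)
    rw [sub_self] at h1
    have hsub : Tendsto (fun r : ℝ => r - s) (𝓝[>] s) (𝓝[>] 0) := by
      refine tendsto_nhdsWithin_iff.2 ⟨?_, ?_⟩
      · have : Tendsto (fun r : ℝ => r - s) (𝓝 s) (𝓝 (s - s)) := tendsto_id.sub_const s
        rw [sub_self] at this
        exact this.mono_left nhdsWithin_le_nhds
      · filter_upwards [self_mem_nhdsWithin] with r hr using mem_Ioi.2 (sub_pos.2 hr)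
    have htr : Tendsto (fun r : ℝ => t - r) (𝓝[>] s) (𝓝 (t - s)) :=
      (tendsto_id.const_sub t).mono_left nhdsWithin_le_nhds
    have hmem : ∀ᶠ r in 𝓝[>] s, r ∈ Ioo s t := Ioo_mem_nhdsGT hs.2
    have h2 := hT.1.tendsto_apply htr (hmem.mono fun r hr => (sub_pos.2 hr.2).le)
      (sub_pos.2 hs.2).le (h1.comp hsub)
    rw [map_zero] at h2
    rw [← hasDerivWithinAt_Ioi_iff_Ici, hasDerivWithinAt_iff_tendsto_slope' self_notMem_Ioi]
    refine h2.congr' ?_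
    filter_upwards [hmem] with r hr
    have hrs : 0 ≤ r - s := (sub_pos.2 hr.1).le
    have e1 : S (r - s) (S s x) = S r x := by
      rw [← ContinuousLinearMap.comp_apply, ← hS.1.map_add _ _ hrs hs.1, sub_add_cancel]
    have e2 : T (t - r) (T (r - s) (S s x)) = T (t - s) (S s x) := by
      rw [← ContinuousLinearMap.comp_apply, ← hT.1.map_add _ _ (sub_pos.2 hr.2).le hrs,
        sub_add_sub_cancel]
    rw [slope_def_module, ← e2, ← e1, ← Complex.coe_smul]
    simp [← smul_sub]
  have h := constant_of_has_deriv_right_zero hcont hderiv t ⟨ht, le_rfl⟩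
  simpa [hS.1.map_zero, hT.1.map_zero] using h

end Semigroup

/-! ### The convolution of the diagonal semigroups -/

section Convolution

variable {X Y : Type*} [NormedAddCommGroup X] [NormedSpace ℂ X]
  [NormedAddCommGroup Y] [NormedSpace ℂ Y] {TA : ℝ → X →L[ℂ] X} {TD : ℝ → Y →L[ℂ] Y}

lemma UniformlyExpStable.tendsto_zero (hA : UniformlyExpStable TA) (x : X) :
    Tendsto (fun t => TA t x) atTop (𝓝 0) := by
  obtain ⟨M, ω, hω, hM⟩ := hA
  have h1 : Tendsto (fun s : ℝ => M * Real.exp (-ω * s) * ‖x‖) atTop (𝓝 0) := by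
    have : Tendsto (fun s : ℝ => Real.exp (-ω * s)) atTop (𝓝 0) :=
      Real.tendsto_exp_atBot.comp (tendsto_id.const_mul_atTop_of_neg (neg_lt_zero.2 hω))
    simpa using (this.const_mul M).mul_const ‖x‖
  exact squeeze_zero_norm' ((eventually_ge_atTop 0).mono fun s hs =>
    (TA s).le_of_opNorm_le (hM s hs) x) h1

lemma exists_norm_convolutionR_le (hA : UniformlyExpStable TA) (hD : BoundedSemigroup TD)
    (C : X →L[ℂ] Y) :
    ∃ K : ℝ, 0 ≤ K ∧ ∀ t, 0 ≤ t → ∀ x, ‖convolutionR TA C TD t x‖ ≤ K * ‖x‖ := by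
  obtain ⟨M, ω, hω, hM⟩ := hA
  obtain ⟨N, hN⟩ := hD
  have hM0 : 0 ≤ M := by simpa using (norm_nonneg _).trans (hM 0 le_rfl)
  have hN0 : 0 ≤ N := (norm_nonneg _).trans (hN 0 le_rfl)
  refine ⟨N * ‖C‖ * M / ω, by positivity, fun t ht x => ?_⟩
  have hexp : ∫ s in (0 : ℝ)..t, Real.exp (-ω * s) = (1 - Real.exp (-ω * t)) / ω := by
    rw [intervalIntegral.integral_comp_mul_left (fun s => Real.exp s) (neg_ne_zero.2 hω.ne'),
      integral_exp, mul_zero, Real.exp_zero, smul_eq_mul]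
    field_simp
    ring
  calc ‖convolutionR TA C TD t x‖
      ≤ ∫ s in (0 : ℝ)..t, N * ‖C‖ * M * ‖x‖ * Real.exp (-ω * s) := by
        refine intervalIntegral.norm_integral_le_of_norm_le ht (Eventually.of_forall fun s hs => ?_)
          (Continuous.intervalIntegrable (by fun_prop) _ _)
        calc ‖TD (t - s) (C (TA s x))‖ ≤ N * (‖C‖ * (M * Real.exp (-ω * s) * ‖x‖)) :=
              (TD (t - s)).le_of_opNorm_le_of_le (hN _ (sub_nonneg.2 hs.2))
                (C.le_opNorm_of_le ((TA s).le_of_opNorm_le (hM s hs.1.le) x))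
          _ = _ := by ring
    _ = N * ‖C‖ * M * ‖x‖ * ((1 - Real.exp (-ω * t)) / ω) := by
        rw [intervalIntegral.integral_const_mul, hexp]
    _ ≤ N * ‖C‖ * M * ‖x‖ * (1 / ω) := by
        gcongr
        linarith [Real.exp_pos (-ω * t)]
    _ = N * ‖C‖ * M / ω * ‖x‖ := by ring

variable [CompleteSpace Y]

lemma continuousOn_convolution_integrand (hA : IsC0Semigroup TA) (hD : IsC0Semigroup TD)
    (C : X →L[ℂ] Y) (t : ℝ) (x : X) :
    ContinuousOn (fun s => TD (t - s) (C (TA s x))) (Icc 0 t) :=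
  hD.continuousOn_apply (by fun_prop) (fun _ ha => sub_nonneg.2 ha.2)
    (C.continuous.comp_continuousOn
      ((hA.continuousOn_orbit x).mono Icc_subset_Ici_self))

lemma intervalIntegrable_convolution_integrand (hA : IsC0Semigroup TA) (hD : IsC0Semigroup TD)
    (C : X →L[ℂ] Y) {t : ℝ} (x : X) {a b : ℝ} (ha : a ∈ Icc 0 t) (hb : b ∈ Icc 0 t) :
    IntervalIntegrable (fun s => TD (t - s) (C (TA s x))) volume a b :=
  ((continuousOn_convolution_integrand hA hD C t x).mono
    (uIcc_subset_Icc ha hb)).intervalIntegrable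

lemma convolutionR_add_time (hA : IsC0Semigroup TA) (hD : IsC0Semigroup TD) (C : X →L[ℂ] Y)
    {s t : ℝ} (hs : 0 ≤ s) (ht : 0 ≤ t) (x : X) :
    convolutionR TA C TD (s + t) x
      = TD s (convolutionR TA C TD t x) + convolutionR TA C TD s (TA t x) := by
  unfold convolutionR
  have hst := add_nonneg hs ht
  rw [← intervalIntegral.integral_add_adjacent_intervals
    (intervalIntegrable_convolution_integrand hA hD C x (t := s + t) (a := 0) (b := t)
      ⟨le_rfl, hst⟩ ⟨ht, by linarith⟩)
    (intervalIntegrable_convolution_integrand hA hD C x ⟨ht, by linarith⟩ ⟨hst, le_rfl⟩)]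
  congr 1
  · rw [← ContinuousLinearMap.intervalIntegral_comp_comm _
      (intervalIntegrable_convolution_integrand hA hD C x ⟨le_rfl, ht⟩ ⟨ht, le_rfl⟩)]
    refine intervalIntegral.integral_congr fun r hr => ?_
    rw [uIcc_of_le ht] at hr
    change TD (s + t - r) _ = TD s (TD (t - r) _)
    rw [← ContinuousLinearMap.comp_apply (TD s), ← hD.map_add s (t - r) hs (sub_nonneg.2 hr.2),
      add_sub_assoc]
  · have : ∫ r in t..(s + t), TD (s + t - r) (C (TA r x))
        = ∫ r in (0 : ℝ)..s, TD (s + t - (r + t)) (C (TA (r + t) x)) := by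
      rw [intervalIntegral.integral_comp_add_right (fun r => TD (s + t - r) (C (TA r x))), zero_add]
    rw [this]
    refine intervalIntegral.integral_congr fun r hr => ?_
    rw [uIcc_of_le hs] at hr
    rw [hA.map_add r t hr.1 ht, ContinuousLinearMap.comp_apply, add_sub_add_right_eq_sub]

lemma tendsto_inv_smul_convolutionR [CompleteSpace X] (hA : IsC0Semigroup TA)
    (hD : IsC0Semigroup TD) (C : X →L[ℂ] Y) (x : X) :
    Tendsto (fun h : ℝ => (h : ℂ)⁻¹ • convolutionR TA C TD h x) (𝓝[>] 0) (𝓝 (C x)) := by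
  refine tendsto_inv_smul_integral (F := fun h s => TD (h - s) (C (TA s x)))
    (fun h _ => continuousOn_convolution_integrand hA hD C h x) fun ε hε => ?_
  have hjoint : ContinuousWithinAt (fun q : ℝ × ℝ => TD q.1 (C (TA q.2 x)))
      (Ici 0 ×ˢ Ici 0) (0, 0) := by
    have h1 : Tendsto (fun q : ℝ × ℝ => q.1) (𝓝[Ici 0 ×ˢ Ici 0] (0, 0)) (𝓝 0) :=
      (continuous_fst.tendsto (0, 0)).mono_left nhdsWithin_le_nhds
    have h2 : Tendsto (fun q : ℝ × ℝ => q.2) (𝓝[Ici 0 ×ˢ Ici 0] (0, 0)) (𝓝 0) :=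
      (continuous_snd.tendsto (0, 0)).mono_left nhdsWithin_le_nhds
    exact hD.tendsto_apply h1 (eventually_mem_nhdsWithin.mono fun q hq => hq.1) le_rfl
      ((C.continuous.tendsto _).comp (hA.tendsto_apply h2
        (eventually_mem_nhdsWithin.mono fun q hq => hq.2) le_rfl tendsto_const_nhds))
  rw [Metric.continuousWithinAt_iff] at hjoint
  obtain ⟨δ, hδ, hjoint⟩ := hjoint ε hε
  filter_upwards [Ioo_mem_nhdsGT hδ] with h hh s hs
  have hs' : 0 ≤ h - s := sub_nonneg.2 hs.2
  have := hjoint (x := (h - s, s)) ⟨hs', hs.1⟩ (by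
    rw [Prod.dist_eq, max_lt_iff, dist_zero_right, dist_zero_right, Real.norm_of_nonneg hs',
      Real.norm_of_nonneg hs.1]
    exact ⟨by linarith [hs.1, hh.2], hs.2.trans_lt hh.2⟩)
  simp only [hA.map_zero, hD.map_zero, ContinuousLinearMap.id_apply, dist_eq_norm] at this
  exact this.le

/-- After a long time `S` the semigroup `TA` has decayed, so from then on the convolution nearly
follows the orbit under `TD` of the vector it has reached at time `S`. -/
lemma exists_norm_convolutionR_sub_le (hA : IsC0Semigroup TA) (hD : IsC0Semigroup TD)
    (hstable : UniformlyExpStable TA) (hbounded : BoundedSemigroup TD) (C : X →L[ℂ] Y) (x : X)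
    {ε : ℝ} (hε : 0 < ε) :
    ∃ S : ℝ, 0 ≤ S ∧ ∃ y : Y, ∀ t, S ≤ t → ‖convolutionR TA C TD t x - TD (t - S) y‖ ≤ ε := by
  obtain ⟨K, hK0, hK⟩ := exists_norm_convolutionR_le hstable hbounded C
  have hdecay : Tendsto (fun s => K * ‖TA s x‖) atTop (𝓝 0) := by
    simpa using (hstable.tendsto_zero x).norm.const_mul K
  obtain ⟨S, hS0, hS⟩ :=
    ((eventually_ge_atTop (0 : ℝ)).and (hdecay.eventually (gt_mem_nhds hε))).exists
  refine ⟨S, hS0, convolutionR TA C TD S x, fun t ht => ?_⟩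
  have := convolutionR_add_time hA hD C (sub_nonneg.2 ht) hS0 x
  rw [sub_add_cancel] at this
  rw [this, add_sub_cancel_left]
  exact (hK _ (sub_nonneg.2 ht) _).trans hS.le

lemma exists_clm_eq_convolutionR (hA : IsC0Semigroup TA) (hD : IsC0Semigroup TD)
    (hstable : UniformlyExpStable TA) (hbounded : BoundedSemigroup TD) (C : X →L[ℂ] Y) :
    ∃ R : ℝ → X →L[ℂ] Y, ∀ t, 0 ≤ t → ∀ x, R t x = convolutionR TA C TD t x := by
  obtain ⟨K, hK0, hK⟩ := exists_norm_convolutionR_le hstable hbounded C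
  have : ∀ t, ∃ R : X →L[ℂ] Y, 0 ≤ t → ∀ x, R x = convolutionR TA C TD t x := by
    intro t
    by_cases ht : 0 ≤ t
    · have hint := fun x => intervalIntegrable_convolution_integrand hA hD C x (t := t)
        ⟨le_rfl, ht⟩ ⟨ht, le_rfl⟩
      let R : X →ₗ[ℂ] Y :=
        { toFun := convolutionR TA C TD t
          map_add' := fun x z => by
            simp only [convolutionR, map_add]
            exact intervalIntegral.integral_add (hint x) (hint z)
          map_smul' := fun c x => by
            simp only [convolutionR, map_smul, RingHom.id_apply]
            exact intervalIntegral.integral_smul c _ }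
      exact ⟨R.mkContinuous K (hK t ht), fun _ _ => rfl⟩
    · exact ⟨0, fun h => absurd h ht⟩
  choose R hR using this
  exact ⟨R, hR⟩

end Convolution

/-! ### The semigroup of the operator matrix -/

section OperatorMatrix

variable {X Y : Type*} [NormedAddCommGroup X] [NormedSpace ℂ X] [CompleteSpace X]
  [NormedAddCommGroup Y] [NormedSpace ℂ Y] [CompleteSpace Y]
  {A : X →ₗ.[ℂ] X} {D : Y →ₗ.[ℂ] Y} {TA : ℝ → X →L[ℂ] X} {TD : ℝ → Y →L[ℂ] Y}

lemma operatorMatrix_zero_apply {X Y : Type*} [NormedAddCommGroup X] [NormedSpace ℂ X]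
    [NormedAddCommGroup Y] [NormedSpace ℂ Y] (A : X →ₗ.[ℂ] X) (C : X →L[ℂ] Y) (D : Y →ₗ.[ℂ] Y)
    (u : (operatorMatrix A 0 C D).domain) :
    operatorMatrix A 0 C D u = (A ⟨u.1.1, u.2.1⟩, C u.1.1 + D ⟨u.1.2, u.2.2⟩) :=
  Prod.ext (add_zero _) rfl

lemma mem_graph_operatorMatrix_iff {X Y : Type*} [NormedAddCommGroup X] [NormedSpace ℂ X]
    [NormedAddCommGroup Y] [NormedSpace ℂ Y] {A : X →ₗ.[ℂ] X} {D : Y →ₗ.[ℂ] Y} (C : X →L[ℂ] Y)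
    (z w : X × Y) :
    (z, w) ∈ (operatorMatrix A 0 C D).graph ↔
      (z.1, w.1) ∈ A.graph ∧ (z.2, w.2 - C z.1) ∈ D.graph := by
  simp only [LinearPMap.mem_graph_iff]
  constructor
  · rintro ⟨u, rfl, rfl⟩
    rw [operatorMatrix_zero_apply]
    exact ⟨⟨⟨u.1.1, u.2.1⟩, rfl, rfl⟩, ⟨⟨u.1.2, u.2.2⟩, rfl, (add_sub_cancel_left _ _).symm⟩⟩
  · rintro ⟨⟨a, ha, ha'⟩, ⟨d, hd, hd'⟩⟩
    refine ⟨⟨z, ha ▸ a.2, hd ▸ d.2⟩, rfl, ?_⟩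
    rw [operatorMatrix_zero_apply]
    refine Prod.ext ?_ ?_
    · rw [← ha']
      exact congrArg A (Subtype.ext ha.symm)
    · rw [← add_sub_cancel (C z.1) w.2, ← hd']
      exact congrArg (C z.1 + D ·) (Subtype.ext hd.symm)

/-- The operator matrix generates the lower triangular semigroup with diagonal entries `TA`, `TD`
and off-diagonal entry the convolution. -/
lemma exists_generates_operatorMatrix (hA : Generates A TA) (hD : Generates D TD)
    (hstable : UniformlyExpStable TA) (hbounded : BoundedSemigroup TD) (C : X →L[ℂ] Y) :
    ∃ T : ℝ → (X × Y) →L[ℂ] (X × Y), Generates (operatorMatrix A 0 C D) T ∧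
      BoundedSemigroup T ∧
      ∀ t, 0 ≤ t → ∀ z, T t z = (TA t z.1, convolutionR TA C TD t z.1 + TD t z.2) := by
  obtain ⟨R, hR⟩ := exists_clm_eq_convolutionR hA.1 hD.1 hstable hbounded C
  obtain ⟨K, hK0, hK⟩ := exists_norm_convolutionR_le hstable hbounded C
  set T : ℝ → (X × Y) →L[ℂ] (X × Y) := fun t =>
    ((TA t).comp (.fst ℂ X Y)).prod ((R t).comp (.fst ℂ X Y) + (TD t).comp (.snd ℂ X Y)) with hTdef
  have hT : ∀ t, 0 ≤ t → ∀ z, T t z = (TA t z.1, convolutionR TA C TD t z.1 + TD t z.2) :=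
    fun t ht z => by simp [hTdef, hR t ht]
  have hTb : BoundedSemigroup T := by
    obtain ⟨M, ω, hω, hM⟩ := hstable
    obtain ⟨N, hN⟩ := hbounded
    have hM0 : 0 ≤ M := by simpa using (norm_nonneg _).trans (hM 0 le_rfl)
    have hN0 : 0 ≤ N := (norm_nonneg _).trans (hN 0 le_rfl)
    refine ⟨M + (K + N), fun t ht => ContinuousLinearMap.opNorm_le_bound _ (by positivity)
      fun z => ?_⟩
    have hM1 : ‖TA t‖ ≤ M := (hM t ht).trans
      (mul_le_of_le_one_right hM0 (Real.exp_le_one_iff.2 (by nlinarith)))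
    have h1 : ‖TA t z.1‖ ≤ M * ‖z‖ :=
      (TA t).le_of_opNorm_le_of_le hM1 (norm_fst_le z)
    have h2 : ‖convolutionR TA C TD t z.1‖ ≤ K * ‖z‖ :=
      (hK t ht z.1).trans (mul_le_mul_of_nonneg_left (norm_fst_le z) hK0)
    have h3 : ‖TD t z.2‖ ≤ N * ‖z‖ :=
      (TD t).le_of_opNorm_le_of_le (hN t ht) (norm_snd_le z)
    have h0 := norm_nonneg z
    rw [hT t ht, Prod.norm_mk]
    refine max_le ?_ ((norm_add_le _ _).trans ?_)
    · nlinarith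
    · nlinarith
  have hquot : ∀ z w : X × Y, (z, w) ∈ (operatorMatrix A 0 C D).graph ↔
      Tendsto (fun t : ℝ => (t : ℂ)⁻¹ • (T t z - z)) (𝓝[>] 0) (𝓝 w) := by
    intro z w
    have hconv := tendsto_inv_smul_convolutionR hA.1 hD.1 C z.1
    have e : (fun t : ℝ => (t : ℂ)⁻¹ • (T t z - z)) =ᶠ[𝓝[>] 0] fun t =>
        ((t : ℂ)⁻¹ • (TA t z.1 - z.1),
          (t : ℂ)⁻¹ • convolutionR TA C TD t z.1 + (t : ℂ)⁻¹ • (TD t z.2 - z.2)) := by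
      filter_upwards [self_mem_nhdsWithin] with t ht
      rw [hT t (le_of_lt ht)]
      refine Prod.ext rfl ?_
      change (t : ℂ)⁻¹ • (convolutionR TA C TD t z.1 + TD t z.2 - z.2) = _
      rw [add_sub_assoc, smul_add]
    rw [mem_graph_operatorMatrix_iff, hA.2, hD.2, tendsto_congr' e, Prod.tendsto_iff]
    refine and_congr_right fun _ => ⟨fun h => ?_, fun h => ?_⟩
    · simpa using hconv.add h
    · simpa using h.sub hconv
  refine ⟨T, ⟨?_, hquot⟩, hTb, hT⟩
  obtain ⟨N, hN⟩ := hTb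
  refine isC0Semigroup_of_bounded ?_ (fun s t hs ht => ?_) hN fun z => ?_
  · refine ContinuousLinearMap.ext fun z => ?_
    rw [hT 0 le_rfl]
    simp [hA.1.map_zero, hD.1.map_zero, convolutionR]
  · refine ContinuousLinearMap.ext fun z => ?_
    rw [ContinuousLinearMap.comp_apply, hT s hs, hT t ht, hT _ (add_nonneg hs ht),
      hA.1.map_add s t hs ht, hD.1.map_add s t hs ht, convolutionR_add_time hA.1 hD.1 C hs ht]
    simp only [ContinuousLinearMap.comp_apply, map_add]
    exact Prod.ext rfl (by change _ + _ + _ = _ + (_ + _); abel)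
  · -- As `R h x / h` has a limit, `R h x` itself tends to zero.
    have hconv : Tendsto (fun h => convolutionR TA C TD h z.1) (𝓝[>] 0) (𝓝 0) := by
      have hid : Tendsto (fun h : ℝ => (h : ℂ)) (𝓝[>] 0) (𝓝 0) :=
        (Complex.continuous_ofReal.tendsto' 0 0 Complex.ofReal_zero).mono_left nhdsWithin_le_nhds
      have := hid.smul (tendsto_inv_smul_convolutionR hA.1 hD.1 C z.1)
      rw [zero_smul] at this
      refine this.congr' ?_
      filter_upwards [self_mem_nhdsWithin] with h hh
      exact smul_inv_smul₀ (Complex.ofReal_ne_zero.2 (ne_of_gt hh)) _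
    have h1 := (hA.1.tendsto_zero_right z.1).prodMk_nhds
      (hconv.add (hD.1.tendsto_zero_right z.2))
    rw [zero_add] at h1
    refine h1.congr' ?_
    filter_upwards [self_mem_nhdsWithin] with t ht
    rw [hT t (le_of_lt ht)]

end OperatorMatrix

/-! ### Asymptotics of the convolution -/

section Asymptotics

variable {X Y : Type*} [NormedAddCommGroup X] [NormedSpace ℂ X]
  [NormedAddCommGroup Y] [NormedSpace ℂ Y] [CompleteSpace Y]
  {TA : ℝ → X →L[ℂ] X} {TD : ℝ → Y →L[ℂ] Y}

lemma tendsto_sub_const_atTop (a : ℝ) : Tendsto (fun t : ℝ => t - a) atTop atTop :=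
  tendsto_atTop_add_const_right atTop (-a) tendsto_id

lemma exists_tendsto_convolutionR (hA : IsC0Semigroup TA) (hD : IsC0Semigroup TD)
    (hstable : UniformlyExpStable TA) (hbounded : BoundedSemigroup TD) (C : X →L[ℂ] Y)
    {P : Y →L[ℂ] Y} (hP : TendstoStrongly TD P) (x : X) :
    ∃ y, Tendsto (fun t => convolutionR TA C TD t x) atTop (𝓝 y) := by
  refine cauchy_map_iff_exists_tendsto.1 (Metric.cauchy_iff.2 ⟨inferInstance, fun ε hε => ?_⟩)
  obtain ⟨S, hS0, y, hy⟩ := exists_norm_convolutionR_sub_le hA hD hstable hbounded C x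
    (ε := ε / 5) (by positivity)
  have h1 := Metric.tendsto_nhds.1 ((hP y).comp (tendsto_sub_const_atTop S)) (ε / 5)
    (by positivity)
  refine ⟨Metric.ball (P y) (ε / 2), ?_, fun a ha b hb => ?_⟩
  · rw [mem_map]
    filter_upwards [h1, eventually_ge_atTop S] with t ht htS
    have h2 := hy t htS
    rw [← dist_eq_norm] at h2
    have := dist_triangle (convolutionR TA C TD t x) (TD (t - S) y) (P y)
    simp only [Function.comp_apply] at ht
    exact Metric.mem_ball.2 (by linarith)
  · have := dist_triangle_right a b (P y)
    linarith [Metric.mem_ball.1 ha, Metric.mem_ball.1 hb]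

lemma tendsto_convolutionR_zero (hA : IsC0Semigroup TA) (hD : IsC0Semigroup TD)
    (hstable : UniformlyExpStable TA) (hbounded : BoundedSemigroup TD) (C : X →L[ℂ] Y)
    (h0 : TendstoStrongly TD 0) (x : X) :
    Tendsto (fun t => convolutionR TA C TD t x) atTop (𝓝 0) := by
  rw [Metric.tendsto_nhds]
  intro ε hε
  obtain ⟨S, hS0, y, hy⟩ := exists_norm_convolutionR_sub_le hA hD hstable hbounded C x
    (half_pos hε)
  have h1 := Metric.tendsto_nhds.1 ((h0 y).comp (tendsto_sub_const_atTop S)) (ε / 2) (half_pos hε)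
  filter_upwards [h1, eventually_ge_atTop S] with t ht htS
  have h2 := hy t htS
  rw [← dist_eq_norm] at h2
  have := dist_triangle (convolutionR TA C TD t x) (TD (t - S) y) 0
  simp only [Function.comp_apply, _root_.zero_apply] at ht
  linarith

lemma asympAlmostPeriodic_convolutionR (hA : IsC0Semigroup TA) (hD : IsC0Semigroup TD)
    (hstable : UniformlyExpStable TA) (hbounded : BoundedSemigroup TD) (C : X →L[ℂ] Y)
    (hap : ∀ y : Y, AsympAlmostPeriodic (fun t : ℝ => TD t y)) (x : X)
    (hcont : ContinuousOn (fun t => convolutionR TA C TD t x) (Ici 0)) :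
    AsympAlmostPeriodic (fun t : ℝ => convolutionR TA C TD t x) := by
  refine asympAlmostPeriodic_of_forall_exists_eventually hcont fun ε hε => ?_
  obtain ⟨S, hS0, y, hy⟩ := exists_norm_convolutionR_sub_le hA hD hstable hbounded C x
    (half_pos hε)
  obtain ⟨p, hp, hyp⟩ := (hap y).exists_eventually_norm_sub_le (half_pos hε)
  refine ⟨fun t => p (t + -S), comp_add_const_mem_trigPolynomials hp (-S), ?_⟩
  filter_upwards [(tendsto_sub_const_atTop S).eventually hyp, eventually_ge_atTop S] with t ht htS
  have := norm_add_le (convolutionR TA C TD t x - TD (t - S) y) (TD (t - S) y - p (t - S))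
  rw [sub_add_sub_cancel] at this
  rw [← sub_eq_add_neg]
  linarith [hy t htS]

lemma exists_tendstoStrongly {E : Type*} [NormedAddCommGroup E] [NormedSpace ℂ E]
    [CompleteSpace E] {T : ℝ → E →L[ℂ] E}
    (h : ∀ x, ∃ y, Tendsto (fun t => T t x) atTop (𝓝 y)) : ∃ Q, TendstoStrongly T Q := by
  choose q hq using h
  exact ⟨continuousLinearMapOfTendsto T (tendsto_pi_nhds.2 hq), hq⟩

end Asymptotics

theorem mainTheorem5 {X Y : Type*}
    [NormedAddCommGroup X] [NormedSpace ℂ X] [CompleteSpace X]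
    [NormedAddCommGroup Y] [NormedSpace ℂ Y] [CompleteSpace Y]
    (A : X →ₗ.[ℂ] X) (D : Y →ₗ.[ℂ] Y) (C : X →L[ℂ] Y)
    (TA : ℝ → X →L[ℂ] X) (TD : ℝ → Y →L[ℂ] Y)
    (hA : Generates A TA) (hD : Generates D TD)
    (hstable : UniformlyExpStable TA) (hbounded : BoundedSemigroup TD) :
    (∃ T : ℝ → (X × Y) →L[ℂ] (X × Y), Generates (operatorMatrix A 0 C D) T) ∧
    (∀ T : ℝ → (X × Y) →L[ℂ] (X × Y), Generates (operatorMatrix A 0 C D) T →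
      BoundedSemigroup T ∧
      ((∃ P : Y →L[ℂ] Y, TendstoStrongly TD P) →
        ∃ Q : (X × Y) →L[ℂ] (X × Y), TendstoStrongly T Q) ∧
      (TendstoStrongly TD 0 → TendstoStrongly T 0)) ∧
    ((∀ y : Y, AsympAlmostPeriodic (fun t : ℝ => TD t y)) →
      ∀ x : X, AsympAlmostPeriodic (fun t : ℝ => convolutionR TA C TD t x)) := by
  obtain ⟨T₀, hgen, ⟨K, hK⟩, hT₀⟩ := exists_generates_operatorMatrix hA hD hstable hbounded C
  refine ⟨⟨T₀, hgen⟩, fun T hT => ?_, fun hap x => ?_⟩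
  · have hTT₀ : ∀ t, 0 ≤ t → T t = T₀ t := fun t ht => hT.unique hgen ht
    have hlim : ∀ (z : X × Y) (y₁ y₂ : Y),
        Tendsto (fun t => convolutionR TA C TD t z.1) atTop (𝓝 y₁) →
        Tendsto (fun t => TD t z.2) atTop (𝓝 y₂) →
        Tendsto (fun t => T t z) atTop (𝓝 (0, y₁ + y₂)) := by
      intro z y₁ y₂ h1 h2
      refine ((hstable.tendsto_zero z.1).prodMk_nhds (h1.add h2)).congr' ?_
      filter_upwards [eventually_ge_atTop 0] with t ht
      rw [hTT₀ t ht, hT₀ t ht]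
    refine ⟨⟨K, fun t ht => hTT₀ t ht ▸ hK t ht⟩, ?_, fun h0 z => ?_⟩
    · rintro ⟨P, hP⟩
      refine exists_tendstoStrongly fun z => ?_
      obtain ⟨y, hy⟩ := exists_tendsto_convolutionR hA.1 hD.1 hstable hbounded C hP z.1
      exact ⟨_, hlim z y _ hy (hP z.2)⟩
    · simpa [← Prod.mk_zero_zero] using hlim z 0 0
        (tendsto_convolutionR_zero hA.1 hD.1 hstable hbounded C h0 z.1) (h0 z.2)
  · -- The convolution is a component of an orbit of a strongly continuous semigroup.
    refine asympAlmostPeriodic_convolutionR hA.1 hD.1 hstable hbounded C hap x ?_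
    refine (continuous_snd.comp_continuousOn (hgen.1.continuousOn_orbit (x, 0))).congr ?_
    intro t ht
    simp [hT₀ t ht]
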